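/- Let $(E,\mathscr E)$ be a measurable space, $\mu$ a probability measure on it, and $L^2(\mu)$ the real Hilbert space of square-integrable functions with $\langle f,g\rangle_\mu=\int fg\,d\mu$. Let $\{P_t,\,t\ge 0\}$ be a strongly continuous Markov semigroup on $L^2(\mu)$ with invariant distribution $\mu$; that is, the $P_t$ are bounded linear operators on $L^2(\mu)$ such that $P_0=\mathrm{Id}$, $P_{s+t}=P_sP_t$, $P_tf\ge 0$ whenever $f\ge 0$, $P_t1=1$, $\int P_tf\,d\mu=\int f\,d\mu$ for all $f\in L^2(\mu)$, and $\lim_{t\downarrow 0}\|P_tf-f\|_\mu=0$ for all $f\in L^2(\mu)$. Let $L$ be its generator: its domain $\mathcal D^2(L,\mu)$ is the set of $f\in L^2(\mu)$ for which $\lim_{t\downarrow 0}t^{-1}(P_tf-f)$ exists in $L^2(\mu)$, and $Lf$ is this limit. Let $Q\colon L^2(\mu)\to L^2(\mu)$ be an isometric involution, that is, a linear operator with $\langle Qf,Qg\rangle_\mu=\langle f,g\rangle_\mu$ for all $f,g\in L^2(\mu)$ and $Q^2=\mathrm{Id}$. The operator $QLQ$ has domain $\{f\in L^2(\mu)\colon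 Qf\in\mathcal D^2(L,\mu)\}$. Let $\mathcal A\subset\mathcal D^2(L,\mu)$ be a linear subspace that is a core for $L$ (the closure of the restriction $L_{|\mathcal A}$ in the graph norm is $L$), and assume that 1. $f\in\mathcal A$ implies $Qf\in\mathcal A$; 2. $\langle Lf,g\rangle_\mu=\langle f,QLQg\rangle_\mu$ for all $f,g\in\mathcal A$. Then $\{P_t,\,t\ge0\}$ is $(\mu,Q)$-self-adjoint, i.e. $\langle P_tf,g\rangle_\mu=\langle f,QP_tQg\rangle_\mu$ for all $f,g\in L^2(\mu)$ and $t\ge 0$; equivalently $P_t^*=QP_tQ$ for all $t\ge0$. Moreover $L$ is densely defined, and its Hilbert-space adjoint satisfies $L^*=QLQ$, including equality of the domains. -/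

import Mathlib

open MeasureTheory Filter Topology
open scoped NNReal LinearPMap

noncomputable section

/-- A linear operator `Q` on a real inner product space is an isometric involution if
`⟨f, g⟩ = ⟨Q f, Q g⟩` for all `f, g` and `Q ∘ Q = Id`. -/
structure IsIsometricInvolution {H : Type*} [NormedAddCommGroup H] [InnerProductSpace ℝ H]
    (Q : H →ₗ[ℝ] H) : Prop where
  inner_map_map : ∀ f g : H, inner ℝ (Q f) (Q g) = inner ℝ f g
  involutive : ∀ f : H, Q (Q f) = f

/-- `P` is a strongly continuous Markov semigroup on `L²(μ)` with invariant distribution `μ`: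
a semigroup of positivity preserving, unit preserving operators which preserve `μ`-integrals and
satisfy `P t f → f` in `L²(μ)` as `t → 0`.
Contractivity of `P t` is a consequence and is not required. -/
structure IsInvariantMarkovSemigroup {E : Type*} [MeasurableSpace E] (μ : Measure E)
    [IsProbabilityMeasure μ] (P : ℝ≥0 → (Lp ℝ 2 μ →L[ℝ] Lp ℝ 2 μ)) : Prop where
  map_zero : P 0 = ContinuousLinearMap.id ℝ (Lp ℝ 2 μ)
  map_add : ∀ s t : ℝ≥0, P (s + t) = (P s).comp (P t)
  nonneg : ∀ (t : ℝ≥0) (f : Lp ℝ 2 μ), 0 ≤ f → 0 ≤ P t f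
  map_one : ∀ t : ℝ≥0, P t (Lp.const 2 μ (1 : ℝ)) = Lp.const 2 μ (1 : ℝ)
  invariant : ∀ (t : ℝ≥0) (f : Lp ℝ 2 μ), ∫ x, P t f x ∂μ = ∫ x, f x ∂μ
  strongly_continuous : ∀ f : Lp ℝ 2 μ, Tendsto (fun t : ℝ≥0 => P t f) (𝓝 0) (𝓝 f)

section Generator

variable {H : Type*} [NormedAddCommGroup H] [NormedSpace ℝ H]

/-- `g` is the limit of `t⁻¹ (P t f - f)` in norm as `t ↓ 0`. -/
def HasGeneratorAt (P : ℝ≥0 → (H →L[ℝ] H)) (f g : H) : Prop :=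
  Tendsto (fun t : ℝ≥0 => (t : ℝ)⁻¹ • (P t f - f)) (𝓝[>] 0) (𝓝 g)

theorem HasGeneratorAt.unique {P : ℝ≥0 → (H →L[ℝ] H)} {f g g' : H}
    (h : HasGeneratorAt P f g) (h' : HasGeneratorAt P f g') : g = g' :=
  tendsto_nhds_unique h h'

theorem HasGeneratorAt.add {P : ℝ≥0 → (H →L[ℝ] H)} {f g f' g' : H}
    (h : HasGeneratorAt P f g) (h' : HasGeneratorAt P f' g') :
    HasGeneratorAt P (f + f') (g + g') := by
  refine (Tendsto.add h h').congr fun t => ?_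
  rw [← smul_add, (P t).map_add]
  congr 1
  abel

theorem HasGeneratorAt.smul {P : ℝ≥0 → (H →L[ℝ] H)} {f g : H} (c : ℝ)
    (h : HasGeneratorAt P f g) : HasGeneratorAt P (c • f) (c • g) := by
  refine (Tendsto.const_smul h c).congr fun t => ?_
  rw [smul_comm, (P t).map_smul, smul_sub]

theorem HasGeneratorAt.zero (P : ℝ≥0 → (H →L[ℝ] H)) : HasGeneratorAt P 0 0 := by
  simp [HasGeneratorAt]

/-- The generator `L` of the semigroup `P`, an unbounded operator: its domain is the set of all
`f` for which `lim_{t ↓ 0} t⁻¹ (P t f - f)` exists in norm, and `L f` is this limit. -/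
def semigroupGenerator (P : ℝ≥0 → (H →L[ℝ] H)) : H →ₗ.[ℝ] H where
  domain :=
    { carrier := {f | ∃ g, HasGeneratorAt P f g}
      add_mem' := fun ⟨_, h⟩ ⟨_, h'⟩ => ⟨_, h.add h'⟩
      zero_mem' := ⟨0, HasGeneratorAt.zero P⟩
      smul_mem' := fun c _ ⟨_, h⟩ => ⟨_, h.smul c⟩ }
  toFun :=
    { toFun := fun f => f.2.choose
      map_add' := fun f f' =>
        (f + f').2.choose_spec.unique (f.2.choose_spec.add f'.2.choose_spec)
      map_smul' := fun c f =>
        (c • f).2.choose_spec.unique (f.2.choose_spec.smul c) }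

theorem mem_domain_semigroupGenerator {P : ℝ≥0 → (H →L[ℝ] H)} {f : H} :
    f ∈ (semigroupGenerator P).domain ↔ ∃ g, HasGeneratorAt P f g :=
  Iff.rfl

theorem hasGeneratorAt_semigroupGenerator (P : ℝ≥0 → (H →L[ℝ] H))
    (f : (semigroupGenerator P).domain) :
    HasGeneratorAt P f (semigroupGenerator P f) :=
  f.2.choose_spec

/-- The unbounded operator `Q L Q`, with domain `{f | Q f ∈ D(L)}`, where `L` is an unbounded
operator and `Q` is everywhere defined. -/
def conjOperator (Q : H →ₗ[ℝ] H) (L : H →ₗ.[ℝ] H) : H →ₗ.[ℝ] H where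
  domain := L.domain.comap Q
  toFun :=
    { toFun := fun f => Q (L ⟨Q f, f.2⟩)
      map_add' := fun f f' => by
        rw [← Q.map_add, ← L.map_add]
        congr 2
        exact Subtype.ext (Q.map_add f f')
      map_smul' := fun c f => by
        rw [RingHom.id_apply, ← Q.map_smul, ← L.map_smul]
        congr 2
        exact Subtype.ext (Q.map_smul c f) }

theorem conjOperator_apply (Q : H →ₗ[ℝ] H) (L : H →ₗ.[ℝ] H)
    (f : (conjOperator Q L).domain) : conjOperator Q L f = Q (L ⟨Q f, f.2⟩) :=
  rfl

end Generator

/-- The semigroup `P` on `L²(μ)` is `(μ, Q)`-self-adjoint: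
`⟨P t f, g⟩ = ⟨f, Q (P t) Q g⟩` for all `f, g ∈ L²(μ)` and `t ≥ 0`. -/
def IsQSelfAdjointSemigroup {E : Type*} [MeasurableSpace E] (μ : Measure E)
    (Q : Lp ℝ 2 μ →ₗ[ℝ] Lp ℝ 2 μ) (P : ℝ≥0 → (Lp ℝ 2 μ →L[ℝ] Lp ℝ 2 μ)) : Prop :=
  ∀ (f g : Lp ℝ 2 μ) (t : ℝ≥0), inner ℝ (P t f) g = inner ℝ f (Q (P t (Q g)))

end

/-! By closing the graph of `L` over the core, the symmetry extends to `⟨Lf, Qg⟩ = ⟨f, QLg⟩` for all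
`f, g` in the domain (`inner_generator_of_core`). For such `f, g` the function `s ↦ ⟨P_s f, Q
P_{t-s} g⟩` on `[0, t]` has zero right derivative, hence is constant. Comparing endpoints, and using
that the domain is dense, gives `P_t* = Q P_t Q` (`inner_eq`).

The symmetry on the domain also says `QLQ ⊆ L*`. Conversely, let `g` be in the domain of `L*` and `k
= L* g`. Differentiating `⟨P_s f, g⟩` and moving `P_s` across the inner product bounds `P_t Qg - Qg
- t Qk` by `t` times the oscillation of `P_s Qk` on `[0, t]`. Hence `Qg` is in the domain of `L` and
`LQg = Qk` (`hasGeneratorAt_of_inner`). -/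

/-- A family of bounded operators indexed by `ℝ≥0` is a strongly continuous semigroup. -/
structure IsStronglyContinuousSemigroup {H : Type*} [NormedAddCommGroup H] [NormedSpace ℝ H]
    (P : ℝ≥0 → (H →L[ℝ] H)) : Prop where
  map_zero : P 0 = ContinuousLinearMap.id ℝ H
  map_add : ∀ s t : ℝ≥0, P (s + t) = (P s).comp (P t)
  tendsto : ∀ f : H, Tendsto (fun t : ℝ≥0 => P t f) (𝓝 0) (𝓝 f)

theorem IsInvariantMarkovSemigroup.isStronglyContinuousSemigroup {E : Type*} [MeasurableSpace E]
    {μ : Measure E} [IsProbabilityMeasure μ] {P : ℝ≥0 → (Lp ℝ 2 μ →L[ℝ] Lp ℝ 2 μ)}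
    (hP : IsInvariantMarkovSemigroup μ P) : IsStronglyContinuousSemigroup P :=
  ⟨hP.map_zero, hP.map_add, hP.strongly_continuous⟩

/-! ### One-sided derivatives as limits over `ℝ≥0`. -/

theorem tendsto_toNNReal_nhdsGT_zero : Tendsto Real.toNNReal (𝓝[>] 0) (𝓝[>] 0) := by
  refine tendsto_nhdsWithin_iff.2 ⟨?_, ?_⟩
  · have h : Tendsto Real.toNNReal (𝓝 0) (𝓝 (Real.toNNReal 0)) :=
      continuous_real_toNNReal.tendsto 0
    rw [Real.toNNReal_zero] at h
    exact h.mono_left nhdsWithin_le_nhds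
  · filter_upwards [self_mem_nhdsWithin] with t ht
    exact Real.toNNReal_pos.2 ht

/-- A right derivative is a limit of right difference quotients. -/
theorem hasDerivWithinAt_Ici_iff_tendsto {H : Type*} [NormedAddCommGroup H] [NormedSpace ℝ H]
    {u : ℝ → H} {u' : H} {a : ℝ} :
    HasDerivWithinAt u u' (Set.Ici a) a ↔
      Tendsto (fun h : ℝ≥0 => (h : ℝ)⁻¹ • (u (a + h) - u a)) (𝓝[>] 0) (𝓝 u') := by
  rw [← hasDerivWithinAt_Ioi_iff_Ici, hasDerivWithinAt_iff_tendsto_slope' (by simp)]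
  constructor
  · intro h
    have hm : Tendsto (fun h : ℝ≥0 => a + (h : ℝ)) (𝓝[>] 0) (𝓝[>] a) := by
      refine tendsto_nhdsWithin_iff.2 ⟨?_, ?_⟩
      · have h : Tendsto (fun h : ℝ≥0 => a + (h : ℝ)) (𝓝 0) (𝓝 (a + ((0 : ℝ≥0) : ℝ))) :=
          Continuous.tendsto (by fun_prop) 0
        rw [NNReal.coe_zero, add_zero] at h
        exact h.mono_left nhdsWithin_le_nhds
      · filter_upwards [self_mem_nhdsWithin] with t ht
        exact lt_add_of_pos_right a (NNReal.coe_pos.2 ht)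
    refine (h.comp hm).congr fun t => ?_
    simp [slope, vsub_eq_sub]
  · intro h
    have hm : Tendsto (fun t : ℝ => (t - a)) (𝓝[>] a) (𝓝[>] 0) := by
      refine tendsto_nhdsWithin_iff.2 ⟨?_, ?_⟩
      · have h : Tendsto (fun t : ℝ => t - a) (𝓝 a) (𝓝 (a - a)) :=
          Continuous.tendsto (by fun_prop) a
        rw [sub_self] at h
        exact h.mono_left nhdsWithin_le_nhds
      · filter_upwards [self_mem_nhdsWithin] with t ht
        exact sub_pos.2 (Set.mem_Ioi.1 ht)
    refine (h.comp (tendsto_toNNReal_nhdsGT_zero.comp hm)).congr' ?_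
    filter_upwards [self_mem_nhdsWithin] with t ht
    have : (0 : ℝ) ≤ t - a := sub_nonneg.2 (le_of_lt ht)
    simp [slope, vsub_eq_sub, Real.coe_toNNReal _ this]

/-! ### Strongly continuous semigroups: local bounds, orbits, density of the domain. -/

namespace IsStronglyContinuousSemigroup

variable {H : Type*} [NormedAddCommGroup H] [NormedSpace ℝ H]
  {P : ℝ≥0 → (H →L[ℝ] H)}

theorem add_apply (hP : IsStronglyContinuousSemigroup P) (s t : ℝ≥0) (f : H) :
    P (s + t) f = P s (P t f) := by
  rw [hP.map_add]; rfl

/-- The operator at the smaller time factors out, which reduces an increment at any time to one at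
time zero. -/
theorem norm_sub_le (hP : IsStronglyContinuousSemigroup P) {M : ℝ} {T s t : ℝ≥0}
    (hM : ∀ r ≤ T, ‖P r‖ ≤ M) (hs : s ≤ T) (ht : t ≤ T) (f : H) :
    ‖P s f - P t f‖ ≤ M * ‖P (nndist s t) f - f‖ := by
  wlog h : s ≤ t generalizing s t
  · rw [norm_sub_rev, nndist_comm]
    exact this ht hs (le_of_not_ge h)
  have hd : t = s + nndist s t := by
    rw [nndist_comm, NNReal.nndist_eq, tsub_eq_zero_of_le h, max_eq_left zero_le,
      add_tsub_cancel_of_le h]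
  conv_lhs => rw [hd]
  rw [hP.add_apply, ← map_sub, norm_sub_rev (P (nndist s t) f)]
  exact (P s).le_of_opNorm_le (hM s hs) _

theorem hasGeneratorAt_apply (hP : IsStronglyContinuousSemigroup P) {f g : H}
    (h : HasGeneratorAt P f g) (t : ℝ≥0) : HasGeneratorAt P (P t f) (P t g) := by
  refine (((P t).continuous.tendsto g).comp h).congr fun s => ?_
  simp only [Function.comp_apply]
  rw [map_smul, map_sub, ← hP.add_apply, add_comm, hP.add_apply]

theorem hasDerivWithinAt (hP : IsStronglyContinuousSemigroup P) {f g : H}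
    (h : HasGeneratorAt P f g) {t : ℝ} (ht : 0 ≤ t) :
    HasDerivWithinAt (fun s : ℝ => P s.toNNReal f) (P t.toNNReal g) (Set.Ici t) t := by
  refine hasDerivWithinAt_Ici_iff_tendsto.2 ((hP.hasGeneratorAt_apply h t.toNNReal).congr fun s => ?_)
  rw [Real.toNNReal_add ht s.coe_nonneg, add_comm, hP.add_apply, Real.toNNReal_coe]

variable [CompleteSpace H]

/-- Otherwise some `t n → 0` has `‖P (t n)‖ > n`, although each sequence `P (t n) x` converges; this
contradicts uniform boundedness. -/
theorem exists_norm_le_near_zero (hP : IsStronglyContinuousSemigroup P) :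
    ∃ δ : ℝ≥0, 0 < δ ∧ ∃ M : ℝ, ∀ t ≤ δ, ‖P t‖ ≤ M := by
  by_contra! hcon
  choose t ht htM using fun n : ℕ => hcon (1 / ((n : ℝ≥0) + 1)) (by positivity) n
  have ht0 : Tendsto t atTop (𝓝 0) :=
    tendsto_of_tendsto_of_tendsto_of_le_of_le tendsto_const_nhds
      tendsto_one_div_add_atTop_nhds_zero_nat (fun n => zero_le) ht
  obtain ⟨C, hC⟩ := banach_steinhaus (g := fun n => P (t n)) fun x => by
    obtain ⟨C, hC⟩ := ((hP.tendsto x).comp ht0).norm.bddAbove_range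
    exact ⟨C, fun n => hC ⟨n, rfl⟩⟩
  obtain ⟨n, hn⟩ := exists_nat_gt C
  exact absurd (hC n) (not_le.2 (hn.trans (htM n)))

theorem exists_norm_le (hP : IsStronglyContinuousSemigroup P) (T : ℝ≥0) :
    ∃ M : ℝ, 0 ≤ M ∧ ∀ t ≤ T, ‖P t‖ ≤ M := by
  obtain ⟨δ, hδ, M, hM⟩ := hP.exists_norm_le_near_zero
  have hM0 : 0 ≤ M := (norm_nonneg _).trans (hM 0 zero_le)
  have key : ∀ n : ℕ, ∃ C : ℝ, 0 ≤ C ∧ ∀ t ≤ n • δ, ‖P t‖ ≤ C := by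
    intro n
    induction n with
    | zero =>
      refine ⟨‖P 0‖, norm_nonneg _, fun t ht => ?_⟩
      rw [zero_smul, nonpos_iff_eq_zero] at ht
      rw [ht]
    | succ n ih =>
      obtain ⟨C, hC0, hC⟩ := ih
      refine ⟨C * M, by positivity, fun t ht => ?_⟩
      -- One more step of length at most `δ` costs one more factor `M`.
      rw [← tsub_add_min (a := t) (b := δ), hP.map_add]
      refine (ContinuousLinearMap.opNorm_comp_le _ _).trans ?_
      refine mul_le_mul (hC _ ?_) (hM _ (min_le_right _ _)) (norm_nonneg _) hC0
      rw [succ_nsmul] at ht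
      exact tsub_le_iff_right.2 ht
  obtain ⟨n, hn⟩ := Archimedean.arch T hδ
  obtain ⟨C, hC0, hC⟩ := key n
  exact ⟨C, hC0, fun t ht => hC t (ht.trans hn)⟩

/-- Joint continuity in time and vector, needed when both vary at once, as in
`hasDerivWithinAt_sub`. -/
theorem tendsto_apply (hP : IsStronglyContinuousSemigroup P) {ι : Type*} {l : Filter ι}
    {s : ι → ℝ≥0} {x : ι → H} {a : ℝ≥0} {y : H} (hs : Tendsto s l (𝓝 a))
    (hx : Tendsto x l (𝓝 y)) : Tendsto (fun i => P (s i) (x i)) l (𝓝 (P a y)) := by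
  obtain ⟨M, hM0, hM⟩ := hP.exists_norm_le (a + 1)
  rw [tendsto_iff_norm_sub_tendsto_zero] at hx ⊢
  have hd : Tendsto (fun i => nndist (s i) a) l (𝓝 0) := by
    simpa using hs.nndist (tendsto_const_nhds (x := a))
  have hy := tendsto_iff_norm_sub_tendsto_zero.1 ((hP.tendsto y).comp hd)
  have hlim : Tendsto (fun i => M * ‖x i - y‖ + M * ‖P (nndist (s i) a) y - y‖) l (𝓝 0) := by
    simpa using (hx.const_mul M).add (hy.const_mul M)
  refine squeeze_zero' (Eventually.of_forall fun i => norm_nonneg _) ?_ hlim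
  have hlt : a < a + 1 := lt_add_of_pos_right a one_pos
  filter_upwards [hs.eventually (gt_mem_nhds hlt)] with i hi
  calc ‖P (s i) (x i) - P a y‖ = ‖P (s i) (x i - y) + (P (s i) y - P a y)‖ := by
        rw [map_sub]; congr 1; abel
    _ ≤ _ := (norm_add_le _ _).trans
        (add_le_add ((P (s i)).le_of_opNorm_le (hM _ hi.le) _)
          (hP.norm_sub_le hM hi.le hlt.le y))

theorem continuous_apply (hP : IsStronglyContinuousSemigroup P) (f : H) :
    Continuous fun t : ℝ => P t.toNNReal f :=
  continuous_iff_continuousAt.2 fun _ =>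
    hP.tendsto_apply (continuous_real_toNNReal.tendsto _) tendsto_const_nhds

/-- The right difference quotient at `s` with step `r` is `-P_{t-s-r}` applied to `r⁻¹ (P_r f - f)`.
-/
theorem hasDerivWithinAt_sub (hP : IsStronglyContinuousSemigroup P) {f g : H}
    (h : HasGeneratorAt P f g) {s t : ℝ} (hst : s < t) :
    HasDerivWithinAt (fun s : ℝ => P (t - s).toNNReal f) (-P (t - s).toNNReal g) (Set.Ici s) s := by
  rw [hasDerivWithinAt_Ici_iff_tendsto]
  have hlim : Tendsto (fun r : ℝ≥0 => (t - s).toNNReal - r) (𝓝[>] 0) (𝓝 (t - s).toNNReal) := by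
    have : Tendsto (fun r : ℝ≥0 => (t - s).toNNReal - r) (𝓝 0) (𝓝 ((t - s).toNNReal - 0)) :=
      Continuous.tendsto (by fun_prop) 0
    rw [tsub_zero] at this
    exact this.mono_left nhdsWithin_le_nhds
  refine (hP.tendsto_apply hlim h).neg.congr' ?_
  have hpos : 0 < (t - s).toNNReal := Real.toNNReal_pos.2 (sub_pos.2 hst)
  filter_upwards [nhdsWithin_le_nhds (gt_mem_nhds hpos)] with r hr
  have h1 : (t - (s + r)).toNNReal = (t - s).toNNReal - r := by
    rw [← sub_sub, NNReal.sub_def, Real.coe_toNNReal _ (sub_pos.2 hst).le]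
  rw [h1, map_smul, map_sub, ← hP.add_apply, tsub_add_cancel_of_le hr.le, ← smul_neg, neg_sub]

/-- Shifting the integral by `r` leaves only its ends: the quotient equals `r⁻¹ (∫_t^{t+r} - ∫_0^r)
P_s f ds`. -/
theorem hasGeneratorAt_integral (hP : IsStronglyContinuousSemigroup P) (f : H) (t : ℝ≥0) :
    HasGeneratorAt P (∫ s in (0 : ℝ)..t, P s.toNNReal f) (P t f - f) := by
  set u : ℝ → H := fun s => P s.toNNReal f with hu
  have hc : Continuous u := hP.continuous_apply f
  have hd : ∀ a : ℝ, HasDerivAt (fun b : ℝ => ∫ s in (0 : ℝ)..b, u s) (u a) a := fun a =>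
    (hc.integral_hasStrictDerivAt 0 a).hasDerivAt
  have h1 := hasDerivWithinAt_Ici_iff_tendsto.1 (hd t).hasDerivWithinAt
  have h0 := hasDerivWithinAt_Ici_iff_tendsto.1 (hd 0).hasDerivWithinAt
  have hval : u t - u 0 = P t f - f := by
    simp [hu, hP.map_zero]
  have hlim := h1.sub h0
  rw [hval] at hlim
  refine hlim.congr fun r => ?_
  have hi : ∀ a b : ℝ, IntervalIntegrable u volume a b := fun a b => hc.intervalIntegrable a b
  have hPr : P r (∫ s in (0 : ℝ)..t, u s) = ∫ s in (r : ℝ)..(t + r : ℝ), u s := by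
    rw [← (P r).intervalIntegral_comp_comm (hi _ _)]
    have : ∫ s in (r : ℝ)..(t + r : ℝ), u s = ∫ s in (0 : ℝ)..t, u (s + r) := by
      rw [intervalIntegral.integral_comp_add_right, zero_add]
    rw [this]
    refine intervalIntegral.integral_congr fun s hs => ?_
    rw [Set.uIcc_of_le t.coe_nonneg] at hs
    simp only [hu]
    rw [Real.toNNReal_add hs.1 r.coe_nonneg, Real.toNNReal_coe, add_comm, hP.add_apply]
  rw [hPr, ← smul_sub, zero_add, intervalIntegral.integral_same, sub_zero,
    ← intervalIntegral.integral_interval_sub_left (hi 0 (t + r)) (hi 0 r)]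
  congr 1
  abel

/-- The averages `r⁻¹ ∫_0^r P_s f ds` lie in the domain and tend to `f`. -/
theorem dense_domain (hP : IsStronglyContinuousSemigroup P) :
    Dense ((semigroupGenerator P).domain : Set H) := by
  intro f
  have hd : HasDerivAt (fun b : ℝ => ∫ s in (0 : ℝ)..b, P s.toNNReal f) (P (0 : ℝ).toNNReal f) 0 :=
    ((hP.continuous_apply f).integral_hasStrictDerivAt 0 0).hasDerivAt
  have h0 := hasDerivWithinAt_Ici_iff_tendsto.1 hd.hasDerivWithinAt
  simp only [zero_add, intervalIntegral.integral_same, sub_zero, Real.toNNReal_zero,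
    hP.map_zero, ContinuousLinearMap.id_apply] at h0
  exact mem_closure_of_tendsto h0 (Eventually.of_forall fun r =>
    (semigroupGenerator P).domain.smul_mem _ ⟨_, hP.hasGeneratorAt_integral f r⟩)

end IsStronglyContinuousSemigroup

/-! ### Continuity of the involution, and approximation from a core. -/

namespace IsIsometricInvolution

variable {H : Type*} [NormedAddCommGroup H] [InnerProductSpace ℝ H] {Q : H →ₗ[ℝ] H}

theorem norm_map (hQ : IsIsometricInvolution Q) (f : H) : ‖Q f‖ = ‖f‖ := by
  rw [@norm_eq_sqrt_real_inner H, @norm_eq_sqrt_real_inner H, hQ.inner_map_map]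

theorem continuous (hQ : IsIsometricInvolution Q) : Continuous Q :=
  (LinearIsometry.mk Q hQ.norm_map).continuous

end IsIsometricInvolution

/-- The graph of an operator is contained in the closure of the graph of its restriction to a
core. -/
theorem mem_closure_graph_of_hasCore {H : Type*} [NormedAddCommGroup H] [NormedSpace ℝ H]
    {L : H →ₗ.[ℝ] H} {A : Submodule ℝ H} (hA : L.HasCore A) (f : L.domain) :
    ((f : H), L f) ∈ closure {p : H × H | ∃ h : p.1 ∈ A, L ⟨p.1, hA.le_domain h⟩ = p.2} := by
  have hsub : ((L.domRestrict A).graph : Set (H × H)) ⊆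
      {p : H × H | ∃ h : p.1 ∈ A, L ⟨p.1, hA.le_domain h⟩ = p.2} := by
    intro p hp
    obtain ⟨y, hy1, hy2⟩ := LinearPMap.mem_graph_iff _ |>.1 hp
    have hyA : p.1 ∈ A := hy1 ▸ y.2.1
    refine ⟨hyA, ?_⟩
    rw [← hy2]
    exact (LinearPMap.domRestrict_apply (y := ⟨p.1, hA.le_domain hyA⟩) hy1).symm
  have hmem : ((f : H), L f) ∈ L.graph := L.mem_graph f
  refine closure_mono hsub ?_
  -- The closure of a non-closable operator is by convention the operator itself; the restriction to
  -- `A` is then already `L`.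
  by_cases hc : (L.domRestrict A).IsClosable
  · have h := hc.graph_closure_eq_closure_graph
    rw [hA.closure_eq] at h
    rw [← h] at hmem
    exact hmem
  · have h := LinearPMap.closure_def' hc
    rw [hA.closure_eq] at h
    have hg := congrArg LinearPMap.graph h
    exact subset_closure (hg ▸ hmem : ((f : H), L f) ∈ (L.domRestrict A).graph)

/-! ### From symmetry of the generator to the adjoints of the semigroup and of `L`. -/

section QSymmetry

variable {H : Type*} [NormedAddCommGroup H] [InnerProductSpace ℝ H]
  {P : ℝ≥0 → (H →L[ℝ] H)} {Q : H →ₗ[ℝ] H}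

theorem mem_domain_of_hasGeneratorAt {f g : H} (h : HasGeneratorAt P f g) :
    f ∈ (semigroupGenerator P).domain :=
  ⟨g, h⟩

theorem semigroupGenerator_apply_eq {f g : H} (h : HasGeneratorAt P f g) :
    semigroupGenerator P ⟨f, mem_domain_of_hasGeneratorAt h⟩ = g :=
  (hasGeneratorAt_semigroupGenerator P _).unique h

/-- A symmetry relation between `L` and `Q L Q` on a core extends to the domain of `L`. -/
theorem inner_generator_of_core (hQ : IsIsometricInvolution Q) {A : Submodule ℝ H}
    (hA : (semigroupGenerator P).HasCore A) (hQA : ∀ f ∈ A, Q f ∈ A)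
    (hsymm : ∀ (f g : H) (hf : f ∈ A) (hg : g ∈ A),
      inner ℝ (semigroupGenerator P ⟨f, hA.le_domain hf⟩) g =
        inner ℝ f (conjOperator Q (semigroupGenerator P) ⟨g, hA.le_domain (hQA g hg)⟩))
    {f f' g g' : H} (hf : HasGeneratorAt P f f') (hg : HasGeneratorAt P g g') :
    inner ℝ f' (Q g) = inner ℝ f (Q g') := by
  set S := {p : H × H | ∃ h : p.1 ∈ A, semigroupGenerator P ⟨p.1, hA.le_domain h⟩ = p.2}
  have hcl : ∀ {f f' : H}, HasGeneratorAt P f f' → (f, f') ∈ closure S := fun {f f'} h => by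
    have := mem_closure_graph_of_hasCore hA ⟨f, mem_domain_of_hasGeneratorAt h⟩
    rwa [semigroupGenerator_apply_eq h] at this
  have hcont := hQ.continuous
  have hclosed : IsClosed {q : (H × H) × (H × H) |
      inner ℝ q.1.2 (Q q.2.1) = inner ℝ q.1.1 (Q q.2.2)} :=
    isClosed_eq (by fun_prop) (by fun_prop)
  have hmem : ((f, f'), (g, g')) ∈ closure (S ×ˢ S) := by
    rw [closure_prod_eq]
    exact ⟨hcl hf, hcl hg⟩
  refine closure_minimal ?_ hclosed hmem
  rintro ⟨⟨a, a'⟩, ⟨b, b'⟩⟩ ⟨⟨ha, haa⟩, ⟨hb, hbb⟩⟩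
  -- Testing against `Q b` makes the inner `Q` of `QLQ` cancel.
  have h := hsymm a (Q b) ha (hQA b hb)
  rw [conjOperator_apply] at h
  simp only [hQ.involutive] at h
  simp only at haa hbb
  rw [haa, hbb] at h
  exact h

variable [CompleteSpace H]

/-- If `L` and `Q L Q` are formally adjoint, then so are `P t` and `Q (P t) Q`. -/
theorem IsStronglyContinuousSemigroup.inner_eq (hP : IsStronglyContinuousSemigroup P)
    (hQ : IsIsometricInvolution Q)
    (hL : ∀ {f f' g g' : H}, HasGeneratorAt P f f' → HasGeneratorAt P g g' →
      inner ℝ f' (Q g) = inner ℝ f (Q g'))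
    (f g : H) (t : ℝ≥0) : inner ℝ (P t f) g = inner ℝ f (Q (P t (Q g))) := by
  have hcont := hQ.continuous
  let Q' : H →L[ℝ] H := ⟨Q, hcont⟩
  have key : ∀ f ∈ (semigroupGenerator P).domain, ∀ g ∈ (semigroupGenerator P).domain,
      inner ℝ (P t f) (Q g) = inner ℝ f (Q (P t g)) := by
    rintro f ⟨f', hf⟩ g ⟨g', hg⟩
    have hc : Continuous fun s : ℝ => inner ℝ (P s.toNNReal f) (Q (P (t - s).toNNReal g)) :=
      (hP.continuous_apply f).inner
        (hcont.comp ((hP.continuous_apply g).comp (continuous_const.sub continuous_id)))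
    -- The two terms of the product rule cancel by `hL`, since orbits stay in the domain.
    have hconst := constant_of_has_deriv_right_zero (a := 0) (b := t) hc.continuousOn
      (fun s hs => by
        have h1 := hP.hasDerivWithinAt hf hs.1
        have h2 := Q'.hasFDerivAt.comp_hasDerivWithinAt s (hP.hasDerivWithinAt_sub hg hs.2)
        have h3 := h1.inner ℝ h2
        refine h3.congr_deriv ?_
        have h4 := hL (hP.hasGeneratorAt_apply hf s.toNNReal)
          (hP.hasGeneratorAt_apply hg (t - s).toNNReal)
        change inner ℝ (P s.toNNReal f) (Q (-P (t - s).toNNReal g')) +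
          inner ℝ (P s.toNNReal f') (Q (P (t - s).toNNReal g)) = 0
        rw [map_neg, inner_neg_right, h4, neg_add_cancel])
      t ⟨t.coe_nonneg, le_rfl⟩
    simpa [hP.map_zero] using hconst
  have hd := hP.dense_domain.prod hP.dense_domain
  have hall : ∀ p : H × H, inner ℝ (P t p.1) (Q p.2) = inner ℝ p.1 (Q (P t p.2)) := by
    have hcl : IsClosed {p : H × H | inner ℝ (P t p.1) (Q p.2) = inner ℝ p.1 (Q (P t p.2))} :=
      isClosed_eq (by fun_prop) (by fun_prop)
    exact fun p => closure_minimal (fun p hp => key p.1 hp.1 p.2 hp.2) hcl (hd p)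
  simpa [hQ.involutive] using hall (f, Q g)

/-- If `P t` and `Q (P t) Q` are adjoint and `⟨L f, g⟩ = ⟨f, k⟩` for all `f` in the domain of the
generator `L`, then `Q g` is in the domain of `L`. -/
theorem IsStronglyContinuousSemigroup.hasGeneratorAt_of_inner
    (hP : IsStronglyContinuousSemigroup P) (hQ : IsIsometricInvolution Q)
    (hadj : ∀ (f g : H) (t : ℝ≥0), inner ℝ (P t f) g = inner ℝ f (Q (P t (Q g))))
    {g k : H} (hgk : ∀ {f f' : H}, HasGeneratorAt P f f' → inner ℝ f' g = inner ℝ f k) :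
    HasGeneratorAt P (Q g) (Q k) := by
  -- Dividing by `t` gives the claim, as `C` can be made small for small `t` by strong continuity at
  -- `Q k`.
  have key : ∀ (t : ℝ≥0) (C : ℝ), (∀ s ≤ t, ‖P s (Q k) - Q k‖ ≤ C) →
      ‖P t (Q g) - Q g - (t : ℝ) • Q k‖ ≤ C * t := by
    intro t C hC
    have hw : ∀ f, |inner ℝ f (Q (P t (Q g) - Q g - (t : ℝ) • Q k))| ≤ C * t * ‖f‖ := by
      have hcl : IsClosed {f : H |
          |inner ℝ f (Q (P t (Q g) - Q g - (t : ℝ) • Q k))| ≤ C * t * ‖f‖} :=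
        isClosed_le (by fun_prop) (by fun_prop)
      refine fun f => closure_minimal ?_ hcl (hP.dense_domain f)
      rintro f ⟨f', hf⟩
      have hder : ∀ s ∈ Set.Ico (0 : ℝ) t, HasDerivWithinAt
          (fun s : ℝ => inner ℝ (P s.toNNReal f) g - s * inner ℝ f k)
          (inner ℝ (P s.toNNReal f') g - inner ℝ f k) (Set.Ici s) s := fun s hs => by
        have h1 := (hP.hasDerivWithinAt hf hs.1).inner ℝ (hasDerivWithinAt_const s (Set.Ici s) g)
        have h2 := (hasDerivWithinAt_id s (Set.Ici s)).mul_const (inner ℝ f k)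
        refine (h1.sub h2).congr_deriv ?_
        rw [inner_zero_right, zero_add, one_mul]
      have hc : Continuous fun s : ℝ => inner ℝ (P s.toNNReal f) g - s * inner ℝ f k :=
        ((hP.continuous_apply f).inner continuous_const).sub
          (continuous_id.mul continuous_const)
      have hb := norm_image_sub_le_of_norm_deriv_right_le_segment (C := C * ‖f‖)
        hc.continuousOn hder (fun s hs => by
          have hst : s.toNNReal ≤ t := Real.toNNReal_le_iff_le_coe.2 hs.2.le
          -- The derivative becomes `⟨f, Q P_s Q k - k⟩`, with no norm of `f'`, so the bound extends
          -- from the domain to all `f`.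
          rw [hgk (hP.hasGeneratorAt_apply hf _), hadj, ← inner_sub_right]
          have h := norm_inner_le_norm (𝕜 := ℝ) f (Q (P s.toNNReal (Q k)) - k)
          refine h.trans ?_
          rw [mul_comm]
          refine mul_le_mul_of_nonneg_right ?_ (norm_nonneg f)
          rw [← hQ.norm_map, map_sub, hQ.involutive]
          exact hC _ hst) t ⟨t.coe_nonneg, le_rfl⟩
      have hval : inner ℝ f (Q (P t (Q g) - Q g - (t : ℝ) • Q k)) =
          inner ℝ (P t f) g - t * inner ℝ f k - inner ℝ f g := by
        rw [map_sub, map_sub, map_smul, hQ.involutive, hQ.involutive, inner_sub_right,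
          inner_sub_right, inner_smul_right, ← hadj]
        ring
      change |inner ℝ f (Q (P t (Q g) - Q g - (t : ℝ) • Q k))| ≤ C * t * ‖f‖
      rw [hval]
      simp only [Real.toNNReal_coe, Real.toNNReal_zero, hP.map_zero,
        ContinuousLinearMap.id_apply, zero_mul, sub_zero, Real.norm_eq_abs] at hb
      linarith
    have hC0 : 0 ≤ C * t := mul_nonneg ((norm_nonneg _).trans (hC 0 zero_le)) t.coe_nonneg
    -- Testing on the vector itself turns the weak bound into a norm bound.
    have h := hw (Q (P t (Q g) - Q g - (t : ℝ) • Q k))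
    rw [real_inner_self_eq_norm_sq, abs_of_nonneg (sq_nonneg _), hQ.norm_map, sq] at h
    rcases (norm_nonneg (P t (Q g) - Q g - (t : ℝ) • Q k)).eq_or_lt with h0 | h0
    · rwa [← h0]
    · exact le_of_mul_le_mul_right h h0
  rw [HasGeneratorAt, Metric.tendsto_nhds]
  intro ε hε
  have hev : ∀ᶠ s in 𝓝 (0 : ℝ≥0), ‖P s (Q k) - Q k‖ < ε / 2 := by
    simpa [dist_eq_norm] using Metric.tendsto_nhds.1 (hP.tendsto (Q k)) (ε / 2) (half_pos hε)
  obtain ⟨δ, hδ, hδε⟩ := Metric.eventually_nhds_iff.1 hev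
  have hlt : ∀ᶠ t : ℝ≥0 in 𝓝 0, (t : ℝ) < δ :=
    (NNReal.continuous_coe.tendsto 0).eventually (gt_mem_nhds (by simpa using hδ))
  filter_upwards [nhdsWithin_le_nhds hlt, self_mem_nhdsWithin] with t htδ ht
  have ht0 : (0 : ℝ) < t := NNReal.coe_pos.2 ht
  have h := key t (ε / 2) fun s hs => (hδε (by
    rw [NNReal.dist_eq, NNReal.coe_zero, sub_zero, abs_of_nonneg s.coe_nonneg]
    exact lt_of_le_of_lt (NNReal.coe_le_coe.2 hs) htδ)).le
  have heq : (t : ℝ)⁻¹ • (P t (Q g) - Q g) - Q k =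
      (t : ℝ)⁻¹ • (P t (Q g) - Q g - (t : ℝ) • Q k) := by
    rw [smul_sub _ _ ((t : ℝ) • Q k), inv_smul_smul₀ ht0.ne']
  rw [dist_eq_norm, heq, norm_smul, norm_inv, Real.norm_of_nonneg ht0.le, inv_mul_lt_iff₀ ht0]
  nlinarith

end QSymmetry

theorem mainTheorem8 {E : Type*} [MeasurableSpace E] (μ : Measure E) [IsProbabilityMeasure μ]
    (P : ℝ≥0 → (Lp ℝ 2 μ →L[ℝ] Lp ℝ 2 μ)) (hP : IsInvariantMarkovSemigroup μ P)
    (Q : Lp ℝ 2 μ →ₗ[ℝ] Lp ℝ 2 μ) (hQ : IsIsometricInvolution Q)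
    (A : Submodule ℝ (Lp ℝ 2 μ)) (hA : (semigroupGenerator P).HasCore A)
    (hQA : ∀ f ∈ A, Q f ∈ A)
    (hsymm : ∀ (f g : Lp ℝ 2 μ) (hf : f ∈ A) (hg : g ∈ A),
      inner ℝ (semigroupGenerator P ⟨f, hA.le_domain hf⟩) g =
        inner ℝ f (conjOperator Q (semigroupGenerator P) ⟨g, hA.le_domain (hQA g hg)⟩)) :
    IsQSelfAdjointSemigroup μ Q P ∧
      (∀ (t : ℝ≥0) (g : Lp ℝ 2 μ), ContinuousLinearMap.adjoint (P t) g = Q (P t (Q g))) ∧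
      Dense ((semigroupGenerator P).domain : Set (Lp ℝ 2 μ)) ∧
      (semigroupGenerator P)† = conjOperator Q (semigroupGenerator P) := by
  have hS := hP.isStronglyContinuousSemigroup
  have hL : ∀ {f f' g g' : Lp ℝ 2 μ}, HasGeneratorAt P f f' → HasGeneratorAt P g g' →
      inner ℝ f' (Q g) = inner ℝ f (Q g') := inner_generator_of_core hQ hA hQA hsymm
  have hadj := hS.inner_eq hQ hL
  have hd := hS.dense_domain
  refine ⟨hadj, fun t g => ?_, hd, ?_⟩
  · refine ext_inner_left ℝ fun f => ?_
    rw [ContinuousLinearMap.adjoint_inner_right, hadj]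
  · have hle : conjOperator Q (semigroupGenerator P) ≤ (semigroupGenerator P)† := by
      refine LinearPMap.IsFormalAdjoint.le_adjoint hd fun f g => ?_
      have h := hL (hasGeneratorAt_semigroupGenerator P f)
        (hasGeneratorAt_semigroupGenerator P ⟨Q g, g.2⟩)
      rw [conjOperator_apply, ← h]
      simp only [hQ.involutive]
    -- Only the inclusion of the domain of the adjoint in that of `QLQ` remains; the values agree by
    -- `hle`.
    refine (LinearPMap.eq_of_le_of_domain_eq hle (le_antisymm hle.1 fun g hg => ?_)).symm
    refine ⟨_, hS.hasGeneratorAt_of_inner hQ hadj (g := g)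
      (k := (semigroupGenerator P)† ⟨g, hg⟩) fun {f f'} hf => ?_⟩
    have h := LinearPMap.adjoint_isFormalAdjoint hd ⟨g, hg⟩ ⟨f, mem_domain_of_hasGeneratorAt hf⟩
    rw [semigroupGenerator_apply_eq hf] at h
    rw [real_inner_comm, ← h, real_inner_comm]
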